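/- **Setting.** Let $\mathcal T$ be a locally compact, complete, separable metric space. For a class $\mathcal B$ of subsets of $\mathcal T$ and $U\subseteq\mathcal T$ put $g_{\mathcal B}(U)=\bigcap\{V\in\mathcal B: U\subseteq V^\circ\}$. An *indexing collection* is a class $\mathcal A$ of compact connected subsets of $\mathcal T$ (the empty set counting as connected) such that: 1. $\emptyset\in\mathcal A$, and $A^\circ\ne A$ for every $A\in\mathcal A\setminus\{\emptyset,\mathcal T\}$; 2. $\mathcal A$ is closed under intersections of arbitrary nonempty subfamilies; $A\cap B\neq\emptyset$ for all nonempty $A,B\in\mathcal A$; and $\overline{\bigcup_i A_i}\in\mathcal A$ for every increasing sequence $(A_i)$ in $\mathcal A$; 3. the $\sigma$-algebra generated by $\mathcal A$ is the Borel $\sigma$-algebra of $\mathcal T$; 4. there is a sequence $(\mathcal A_n)_{n\in\mathbb N}$ that *separates $\mathcal A$ from above*: an increasing sequence of finite subclasses of $\mathcal A$, each containing $\emptyset$ and closed under intersections, such that $g_n(U):=g_{\mathcal A_n}(U)\in\mathcal A_n$ for all $n$ and all $U\in\mathcal A$, and $U=\bigcap_n g_n(U)$ for all $U\in\mathcal A$.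 Fix an indexing collection $\mathcal A$, a sequence $(\mathcal A_n)$ that separates it from above, and a pseudo-distance $d$ on $\mathcal A$. Let $k_n=\#\mathcal A_n$. Assume that $(\mathcal A_n)$ is admissible, i.e. $\sum_n k_{n+1}/k_n^{1+\delta}<\infty$ for every $\delta>0$, and that there are $q,M>0$ with $$d(U,g_n(U))\le M\,k_n^{-1/q}\qquad\text{for all } n\in\mathbb N,\ U\in\mathcal A .$$ Let $X=\{X_U;U\in\mathcal A\}$ be a real centered Gaussian process on a probability space $(\Omega,\mathcal F,\mathbf P)$, separable in the sense of Doob: there are a countable $\mathcal S\subseteq\mathcal A$ and a null set $\Lambda$ such that for every closed $F\subseteq\mathbb R$ and every $d$-open $\mathcal O\subseteq\mathcal A$, $\{X_U\in F\ \forall U\in\mathcal O\cap\mathcal S\}\setminus\{X_U\in F\ \forall U\in\mathcal O\}\subseteq\Lambda$. **Exponents.** Let $B(U_0,\rho)$ be the open $d$-ball. For $f:\mathcal A\to\mathbb R$ and $U_0\in\mathcal A$ define, in $[-\infty,\infty]$, $$\boldsymbol\alpha_f(U_0)=\sup\Big\{\alpha\in\mathbb R:\limsup_{\rho\to0^+}\sup_{U,V\in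 B(U_0,\rho)}\frac{|f(U)-f(V)|}{\rho^{\alpha}}<\infty\Big\},\quad \widetilde{\boldsymbol\alpha}_f(U_0)=\sup\Big\{\alpha\in\mathbb R:\limsup_{\rho\to0^+}\sup_{U,V\in B(U_0,\rho)}\frac{|f(U)-f(V)|}{d(U,V)^{\alpha}}<\infty\Big\},$$ with the conventions $0/0=0$, $a/0=\infty$ for $a>0$, $0^{\alpha}=\infty$ for $\alpha<0$, $a/\infty=0$. The random exponents $\boldsymbol\alpha_X(U_0)$, $\widetilde{\boldsymbol\alpha}_X(U_0)$ are those of the sample path $U\mapsto X_U(\omega)$. The deterministic exponents $\mathbb{\alpha}_X(U_0)$ (pointwise) and $\widetilde{\mathbb{\alpha}}_X(U_0)$ (local) are the suprema of the real $\sigma$ for which the same $\limsup$ is finite with $|f(U)-f(V)|$ replaced by $\mathbf E[(X_U-X_V)^2]$ and with $\rho^{\alpha}$, resp. $d(U,V)^{\alpha}$, replaced by $\rho^{2\sigma}$, resp. $d(U,V)^{2\sigma}$. For $\phi:\mathcal A\to[-\infty,\infty]$ put $\liminf_{U\to U_0}\phi(U)=\lim_{\rho\to0^+}\inf_{B(U_0,\rho)}\phi$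 and $\limsup_{U\to U_0}\phi(U)=\lim_{\rho\to0^+}\sup_{B(U_0,\rho)}\phi$ (the point $U_0$ is included). **Theorem.** Suppose that $\liminf_{U\to U_0}\widetilde{\mathbb{\alpha}}_X(U)>0$ and $\liminf_{U\to U_0}\mathbb{\alpha}_X(U)>0$ for every $U_0\in\mathcal A$. Then, with probability one, $$\forall U_0\in\mathcal A,\qquad \liminf_{U\to U_0}\widetilde{\mathbb{\alpha}}_X(U)\ \le\ \widetilde{\boldsymbol\alpha}_X(U_0)\ \le\ \limsup_{U\to U_0}\widetilde{\mathbb{\alpha}}_X(U),$$ and, with probability one, $$\forall U_0\in\mathcal A,\qquad \liminf_{U\to U_0}\mathbb{\alpha}_X(U)\ \le\ \boldsymbol\alpha_X(U_0).$$ -/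

import Mathlib

open Filter Topology MeasureTheory ProbabilityTheory
open scoped ENNReal

namespace SetIndexed

section Collections

variable {T : Type*} [TopologicalSpace T]

/-- The intersection of all the members of `𝓑` whose interior contains `U`. -/
def outerApprox (𝓑 : Set (Set T)) (U : Set T) : Set T :=
  ⋂₀ {V | V ∈ 𝓑 ∧ U ⊆ interior V}

/-- `(𝓐ₙ)` separates the class `𝓐` from above: it is an increasing sequence of finite subclasses
of `𝓐`, containing `∅` and closed under intersections, such that
`gₙ(U) = ⋂ {V ∈ 𝓐ₙ : U ⊆ V°}` defines functions `gₙ : 𝓐 → 𝓐ₙ` with `U = ⋂ₙ gₙ(U)` for all `U`. -/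
structure SeparatesFromAbove (𝓐 : Set (Set T)) (𝓐seq : ℕ → Set (Set T)) : Prop where
  subset : ∀ n, 𝓐seq n ⊆ 𝓐
  mono : Monotone 𝓐seq
  finite : ∀ n, (𝓐seq n).Finite
  empty_mem : ∀ n, ∅ ∈ 𝓐seq n
  inter_mem : ∀ n, ∀ V ∈ 𝓐seq n, ∀ W ∈ 𝓐seq n, V ∩ W ∈ 𝓐seq n
  approx_mem : ∀ n, ∀ U ∈ 𝓐, outerApprox (𝓐seq n) U ∈ 𝓐seq n
  eq_iInter : ∀ U ∈ 𝓐, U = ⋂ n, outerApprox (𝓐seq n) U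

/-- Indexing collections. The empty set counts as connected here, as `∅` is a member. -/
structure IsIndexingCollection (𝓐 : Set (Set T)) : Prop where
  isCompact : ∀ A ∈ 𝓐, IsCompact A
  isPreconnected : ∀ A ∈ 𝓐, IsPreconnected A
  empty_mem : ∅ ∈ 𝓐
  interior_ne : ∀ A ∈ 𝓐, A ≠ ∅ → A ≠ Set.univ → interior A ≠ A
  sInter_mem : ∀ 𝓢 ⊆ 𝓐, 𝓢.Nonempty → ⋂₀ 𝓢 ∈ 𝓐
  inter_nonempty : ∀ A ∈ 𝓐, ∀ B ∈ 𝓐, A.Nonempty → B.Nonempty → (A ∩ B).Nonempty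
  closure_iUnion_mem : ∀ A : ℕ → Set T, Monotone A → (∀ i, A i ∈ 𝓐) → closure (⋃ i, A i) ∈ 𝓐
  generateFrom_eq : MeasurableSpace.generateFrom 𝓐 = borel T
  exists_separates : ∃ 𝓐seq : ℕ → Set (Set T), SeparatesFromAbove 𝓐 𝓐seq

/-- The map `gₙ`, with values in `𝓐ₙ`, seen as a map from `𝓐` to `𝓐`. -/
def SeparatesFromAbove.g {𝓐 : Set (Set T)} {𝓐seq : ℕ → Set (Set T)}
    (h : SeparatesFromAbove 𝓐 𝓐seq) (n : ℕ) (U : 𝓐) : 𝓐 :=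
  ⟨outerApprox (𝓐seq n) (U : Set T), h.subset n (h.approx_mem n U U.2)⟩

/-- Admissibility of the sequence `kₙ = #𝓐ₙ`: `∑ₙ kₙ₊₁ / kₙ ^ (1 + δ) < ∞` for every `δ > 0`. -/
def Admissible (𝓐seq : ℕ → Set (Set T)) : Prop :=
  ∀ δ : ℝ, 0 < δ →
    Summable fun n : ℕ => ((𝓐seq (n + 1)).ncard : ℝ) / ((𝓐seq n).ncard : ℝ) ^ (1 + δ)

/-- The discretization assumption for Gaussian processes: there are `q, M > 0` such that
`d(U, gₙ(U)) ≤ M kₙ ^ (-1/q)` for all `n` and all `U ∈ 𝓐`, where `kₙ = #𝓐ₙ`. -/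
def DiscretizationAssumption {𝓐 : Set (Set T)} [PseudoMetricSpace 𝓐] {𝓐seq : ℕ → Set (Set T)}
    (h : SeparatesFromAbove 𝓐 𝓐seq) : Prop :=
  ∃ q : ℝ, 0 < q ∧ ∃ M : ℝ, 0 < M ∧ ∀ (n : ℕ) (U : 𝓐),
    dist U (h.g n U) ≤ M * ((𝓐seq n).ncard : ℝ) ^ (-1 / q)

end Collections

section Exponents

variable {E : Type*} [PseudoMetricSpace E]

/-- Pointwise Hölder exponent of `f` at `x₀`, as an extended real. -/
noncomputable def pointwiseExponent (f : E → ℝ) (x₀ : E) : EReal :=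
  ⨆ α ∈ {α : ℝ | limsup (fun ρ : ℝ => ⨆ U ∈ Metric.ball x₀ ρ, ⨆ V ∈ Metric.ball x₀ ρ,
    ‖f U - f V‖ₑ / ENNReal.ofReal ρ ^ α) (𝓝[>] 0) < ∞}, (α : EReal)

/-- Local Hölder exponent of `f` at `x₀`, as an extended real. The quotient is taken in `[0, ∞]`,
where `0 / 0 = 0` and `a / 0 = ∞` for `a > 0`, so that finiteness of the `limsup` for `α > 0` means
that `|f U - f V| ≤ M d(U, V) ^ α` on a ball around `x₀`, for some finite `M`. -/
noncomputable def localExponent (f : E → ℝ) (x₀ : E) : EReal :=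
  ⨆ α ∈ {α : ℝ | limsup (fun ρ : ℝ => ⨆ U ∈ Metric.ball x₀ ρ, ⨆ V ∈ Metric.ball x₀ ρ,
    ‖f U - f V‖ₑ / edist U V ^ α) (𝓝[>] 0) < ∞}, (α : EReal)

variable {Ω : Type*} [MeasurableSpace Ω]

/-- Deterministic pointwise Hölder exponent of the process `X` at `x₀`. -/
noncomputable def detPointwiseExponent (X : E → Ω → ℝ) (P : Measure Ω) (x₀ : E) : EReal :=
  ⨆ σ ∈ {σ : ℝ | limsup (fun ρ : ℝ => ⨆ U ∈ Metric.ball x₀ ρ, ⨆ V ∈ Metric.ball x₀ ρ,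
    (∫⁻ ω, ‖X U ω - X V ω‖ₑ ^ 2 ∂P) / ENNReal.ofReal ρ ^ (2 * σ)) (𝓝[>] 0) < ∞}, (σ : EReal)

/-- Deterministic local Hölder exponent of the process `X` at `x₀`. -/
noncomputable def detLocalExponent (X : E → Ω → ℝ) (P : Measure Ω) (x₀ : E) : EReal :=
  ⨆ σ ∈ {σ : ℝ | limsup (fun ρ : ℝ => ⨆ U ∈ Metric.ball x₀ ρ, ⨆ V ∈ Metric.ball x₀ ρ,
    (∫⁻ ω, ‖X U ω - X V ω‖ₑ ^ 2 ∂P) / edist U V ^ (2 * σ)) (𝓝[>] 0) < ∞}, (σ : EReal)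

/-- Separability of a process in the sense of Doob. -/
def IsSeparableProcess (X : E → Ω → ℝ) (P : Measure Ω) : Prop :=
  ∃ S : Set E, S.Countable ∧ ∃ Λ : Set Ω, P Λ = 0 ∧
    ∀ F : Set ℝ, IsClosed F → ∀ O : Set E, IsOpen O →
      {ω | ∀ U ∈ O ∩ S, X U ω ∈ F} \ {ω | ∀ U ∈ O, X U ω ∈ F} ⊆ Λ

end Exponents

end SetIndexed

/-! Put `κ n = k_n ^ (-1/q)`, and let σ(U, V) be the standard deviation of X_U - X_V.

Lower bounds. A union bound over the finite pairs at consecutive levels, with a Gaussian moment of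
high order and Borel–Cantelli (`ae_incrementsDominated`), gives one almost sure event on which every
increment along the maps g_n is eventually at most `κ n ^ (-η)` σ, for every η > 0. On this event
chaining is a pathwise argument (`chain_bound`): a power bound on σ near U₀ passes to the path with
an arbitrarily small loss of exponent. The null set is chosen before U₀, so the bounds hold for all
U₀ at once. Convergence of X along g_n U to X_U is needed only on the countable separating set;
separability carries the estimate to all of 𝓐. This compares the exponents at U₀ itself, which is
stronger than the comparison with the liminf.

Upper bound. A centered Gaussian variable with standard deviation s satisfies s · P(|Y| ≤ a) ≤ 2a,
so a Hölder bound for paths on a fixed ball, if it has positive probability, forces the same bound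
on σ (`incStd_le_of_measure_ne_zero`). Countably many balls, rational exponents and integer
constants suffice (`ae_localExponent_le`). -/

namespace SetIndexed

/-! ### Pathwise chaining along a sequence of scales -/

section Chaining

/-- A sequence of scales: positive, at most one, antitone, summable to every positive power, and
such that two successive scales are comparable up to powers arbitrarily close to one. -/
structure IsScale (κ : ℕ → ℝ) : Prop where
  pos : ∀ n, 0 < κ n
  le_one : ∀ n, κ n ≤ 1
  anti : Antitone κ
  summable : ∀ η : ℝ, 0 < η → Summable fun n => κ n ^ η
  exists_le : ∀ δ : ℝ, 0 < δ → ∃ A : ℝ, 0 < A ∧ ∀ n, κ n ^ (1 + δ) ≤ A * κ (n + 1)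

namespace IsScale

variable {κ : ℕ → ℝ}

theorem tendsto (hκ : IsScale κ) : Tendsto κ atTop (𝓝 0) := by
  have := (hκ.summable 1 one_pos).tendsto_atTop_zero
  simpa using this

theorem exists_level (hκ : IsScale κ) {t : ℝ} (ht : 0 < t) {m : ℕ} (htm : t ≤ κ m) :
    ∃ N, m ≤ N ∧ κ (N + 1) < t ∧ t ≤ κ N := by
  by_contra! h
  have hall : ∀ j, t ≤ κ (m + j) := by
    intro j
    induction j with
    | zero => simpa using htm
    | succ j ih =>
      by_contra! hlt
      exact absurd ih (not_le.2 (h (m + j) (by omega) hlt))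
  obtain ⟨n, hn, hmn⟩ := ((hκ.tendsto.eventually_lt_const ht).and (eventually_ge_atTop m)).exists
  have := hall (n - m)
  rw [Nat.add_sub_cancel' hmn] at this
  linarith

end IsScale

variable {E : Type*} [PseudoMetricSpace E]

theorem abs_sub_le_mul_tsum {y : ℕ → ℝ} {l : ℝ} (hy : Tendsto y atTop (𝓝 l)) {b : ℕ → ℝ}
    (hb : Summable b) (hb0 : ∀ n, 0 ≤ b n) {a : ℝ} (ha : 0 ≤ a) {N : ℕ}
    (h : ∀ n, N ≤ n → |y n - y (n + 1)| ≤ a * b n) :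
    |y N - l| ≤ a * ∑' n, b n := by
  have h1 : Summable fun n => a * b (N + n) :=
    ((hb.comp_injective (add_right_injective N))).mul_left a
  have h2 := dist_le_tsum_of_dist_le_of_tendsto₀ (f := fun n => y (N + n))
    (fun n => a * b (N + n)) (fun n => by
      rw [Real.dist_eq]; exact h (N + n) (by omega)) h1
    (hy.comp (tendsto_add_atTop_nat N |>.congr fun n => by rw [add_comm]))
  simp only [add_zero, Real.dist_eq] at h2
  refine h2.trans ?_
  rw [tsum_mul_left]
  exact mul_le_mul_of_nonneg_left
    (tsum_comp_le_tsum_of_inj hb hb0 (add_right_injective N)) ha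

theorem le_rpow_mul_rpow {a b c θ : ℝ} (ha : 0 ≤ a) (hab : a ≤ b) (hac : a ≤ c)
    (hθ0 : 0 ≤ θ) (hθ1 : θ ≤ 1) : a ≤ b ^ θ * c ^ (1 - θ) := by
  calc a = a ^ (θ + (1 - θ)) := by simp
    _ = a ^ θ * a ^ (1 - θ) := Real.rpow_add_of_nonneg ha hθ0 (by linarith)
    _ ≤ b ^ θ * c ^ (1 - θ) := by
      have : 0 ≤ 1 - θ := by linarith
      have : 0 ≤ b := ha.trans hab
      gcongr

variable {κ : ℕ → ℝ} {g : ℕ → E → E} {M : ℝ} {x : E → ℝ} {σ : E → E → ℝ}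

/-- The increments of `x` along the approximations `g n` are eventually dominated, up to
arbitrarily small powers of the scale, by `σ`. -/
def IncrementsDominated (κ : ℕ → ℝ) (g : ℕ → E → E) (σ : E → E → ℝ) (x : E → ℝ) : Prop :=
  ∀ η : ℝ, 0 < η → ∀ᶠ n in atTop, ∀ U V : E,
    |x (g n U) - x (g n V)| ≤ κ n ^ (-η) * σ (g n U) (g n V) ∧
    |x (g n U) - x (g (n + 1) V)| ≤ κ n ^ (-η) * σ (g n U) (g (n + 1) V)

/-- The path from U to V goes through `g N U` and `g N V`, at the level N where `κ N` is just above
t. The two bounds on σ play different roles: the power `s` of the distance makes the chain summable,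
the power `r` of τ gives the rate in t. Their geometric interpolation, with little weight on the
first, retains any rate below `r`. -/
theorem chain_bound (hκ : IsScale κ) (hM : 0 ≤ M) (hg : ∀ n U, dist U (g n U) ≤ M * κ n)
    (hσ : ∀ U V, 0 ≤ σ U V) (hinc : IncrementsDominated κ g σ x)
    {s r r' C C₂ τ₀ : ℝ} (hs : 0 < s) (hr' : 0 < r') (hr : r' < r) (hC : 0 ≤ C) (hC₂ : 0 ≤ C₂)
    (hτ₀ : 0 < τ₀) :
    ∃ t₀ > 0, ∃ K, 0 ≤ K ∧ ∀ t, 0 < t → t < t₀ → ∀ U V : E,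
      Tendsto (fun n => x (g n U)) atTop (𝓝 (x U)) →
      Tendsto (fun n => x (g n V)) atTop (𝓝 (x V)) →
      dist U V ≤ 2 * t →
      (∀ τ, t ≤ τ → τ < τ₀ → ∀ A B : E, (dist A U ≤ M * τ ∨ dist A V ≤ M * τ) →
        (dist B U ≤ M * τ ∨ dist B V ≤ M * τ) → dist A B ≤ (2 * M + 2) * τ →
        σ A B ≤ C * dist A B ^ s ∧ σ A B ≤ C₂ * τ ^ r) →
      |x U - x V| ≤ K * t ^ r' := by
  have hr0 : 0 < r := hr'.trans hr
  obtain ⟨θ, hθ0, hθ1, δ, hδ, hexp⟩ : ∃ θ : ℝ, 0 < θ ∧ θ < 1 ∧ ∃ δ : ℝ, 0 < δ ∧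
      r * (1 - θ) = (1 + δ) * r' := by
    -- Both sides of the exponent identity equal (r + r') / 2.
    refine ⟨(1 - r' / r) / 2, ?_, ?_, (r / r' - 1) / 2, ?_, ?_⟩
    · have := (div_lt_one hr0).2 hr; linarith
    · have : 0 < r' / r := by positivity
      linarith
    · have := (one_lt_div hr').2 hr; linarith
    · field_simp; ring
  obtain ⟨A, hA, hAκ⟩ := hκ.exists_le δ hδ
  -- Interpolation yields a factor `κ n ^ (s * θ)`: one half absorbs the loss `κ n ^ (-η)`, the
  -- other is summed.
  have hη : 0 < s * θ / 2 := by positivity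
  obtain ⟨n₀, hn₀⟩ := eventually_atTop.1 ((hinc _ hη).and (hκ.tendsto.eventually_lt_const hτ₀))
  set Z := ∑' n, κ n ^ (s * θ / 2) with hZ
  have hsum := hκ.summable _ hη
  have hb0 : ∀ n, 0 ≤ κ n ^ (s * θ / 2) := fun n => Real.rpow_nonneg (hκ.pos n).le _
  have hZ0 : 0 ≤ Z := tsum_nonneg hb0
  set D := (C * (2 * M + 2) ^ s) ^ θ * C₂ ^ (1 - θ) with hD
  have hM2 : 0 ≤ 2 * M + 2 := by linarith
  have hD0 : 0 ≤ D := by positivity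
  refine ⟨κ n₀, hκ.pos _, 3 * D * Z * A ^ r', by positivity, ?_⟩
  intro t ht htn U V hU hV hUV hbound
  obtain ⟨N, hN, hN1, hN2⟩ := hκ.exists_level ht htn.le
  have hκN := hκ.pos N
  have hτN : κ N < τ₀ := (hn₀ N hN).2
  -- the interpolated bound on `σ`
  have key : ∀ n, N ≤ n → ∀ A' B : E, (dist A' U ≤ M * κ n ∨ dist A' V ≤ M * κ n) →
      (dist B U ≤ M * κ n ∨ dist B V ≤ M * κ n) → dist A' B ≤ (2 * M + 2) * κ n →
      κ n ^ (-(s * θ / 2)) * σ A' B ≤ D * κ N ^ (r * (1 - θ)) * κ n ^ (s * θ / 2) := by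
    intro n hn A' B hA' hB hAB
    have hκn := hκ.pos n
    have hle : κ n ≤ κ N := hκ.anti hn
    have hMle : M * κ n ≤ M * κ N := by gcongr
    -- The hypothesis is always used at τ = `κ N`, even for n > N, since it requires t ≤ τ; the
    -- finer scale `κ n` enters through the distance alone.
    obtain ⟨h1, h2⟩ := hbound (κ N) hN2 hτN A' B (hA'.imp (·.trans hMle) (·.trans hMle))
      (hB.imp (·.trans hMle) (·.trans hMle)) (hAB.trans (by gcongr))
    have h3 : σ A' B ≤ C * ((2 * M + 2) * κ n) ^ s := h1.trans (by gcongr)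
    have h4 := le_rpow_mul_rpow (hσ A' B) h3 h2 hθ0.le hθ1.le
    have h5 : (C * ((2 * M + 2) * κ n) ^ s) ^ θ * (C₂ * κ N ^ r) ^ (1 - θ)
        = D * κ N ^ (r * (1 - θ)) * κ n ^ (s * θ) := by
      rw [Real.mul_rpow hM2 hκn.le, ← mul_assoc, Real.mul_rpow (by positivity) (by positivity),
        Real.mul_rpow hC₂ (by positivity), ← Real.rpow_mul hκn.le, ← Real.rpow_mul hκN.le, hD]
      ring
    rw [h5] at h4
    calc κ n ^ (-(s * θ / 2)) * σ A' B
        ≤ κ n ^ (-(s * θ / 2)) * (D * κ N ^ (r * (1 - θ)) * κ n ^ (s * θ)) := by gcongr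
      _ = D * κ N ^ (r * (1 - θ)) * (κ n ^ (-(s * θ / 2)) * κ n ^ (s * θ)) := by ring
      _ = _ := by rw [← Real.rpow_add hκn]; congr 2; ring
  set a := D * κ N ^ (r * (1 - θ)) with ha
  have ha0 : 0 ≤ a := by positivity
  have chain : ∀ W : E, (W = U ∨ W = V) → Tendsto (fun n => x (g n W)) atTop (𝓝 (x W)) →
      |x (g N W) - x W| ≤ a * Z := by
    intro W hW hlim
    refine abs_sub_le_mul_tsum hlim hsum hb0 ha0 fun n hn => ?_
    refine (((hn₀ n (hN.trans hn)).1 W W).2).trans (key n hn _ _ ?_ ?_ ?_)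
    · have := hg n W
      rw [dist_comm] at this
      rcases hW with rfl | rfl
      exacts [Or.inl this, Or.inr this]
    · have h1 := hg (n + 1) W
      have h2 : M * κ (n + 1) ≤ M * κ n := by gcongr; exact hκ.anti n.le_succ
      rw [dist_comm] at h1
      rcases hW with rfl | rfl
      exacts [Or.inl (h1.trans h2), Or.inr (h1.trans h2)]
    · have h1 := hg (n + 1) W
      have h2 : M * κ (n + 1) ≤ M * κ n := by gcongr; exact hκ.anti n.le_succ
      have h3 := hg n W
      have h4 := dist_triangle_left (g n W) (g (n + 1) W) W
      have h5 := hκ.pos n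
      nlinarith
  have hUc := chain U (Or.inl rfl) hU
  have hVc := chain V (Or.inr rfl) hV
  have hmid : |x (g N U) - x (g N V)| ≤ a * Z := by
    have h1 := ((hn₀ N hN).1 U V).1
    have h2 := key N le_rfl (g N U) (g N V) (Or.inl (by rw [dist_comm]; exact hg N U))
      (Or.inr (by rw [dist_comm]; exact hg N V)) (by
        have h3 := hg N U
        have h4 := hg N V
        have h5 := dist_triangle4 (g N U) U V (g N V)
        rw [dist_comm (g N U) U] at h5
        nlinarith)
    refine (h1.trans h2).trans ?_
    gcongr
    exact hsum.le_tsum N fun n _ => hb0 n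
  have htri : |x U - x V| ≤ 3 * (a * Z) := by
    rw [abs_le] at hUc hVc hmid ⊢
    constructor <;> linarith [hUc.1, hUc.2, hVc.1, hVc.2, hmid.1, hmid.2]
  refine htri.trans ?_
  -- Since `κ (N + 1)` < t, comparability of successive scales bounds `κ N ^ (1 + δ)` by A t.
  have hfin : κ N ^ (r * (1 - θ)) ≤ A ^ r' * t ^ r' := by
    rw [hexp, Real.rpow_mul hκN.le, ← Real.mul_rpow hA.le ht.le]
    gcongr
    exact (hAκ N).trans (by gcongr)
  calc 3 * (a * Z) = 3 * D * Z * κ N ^ (r * (1 - θ)) := by rw [ha]; ring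
    _ ≤ 3 * D * Z * (A ^ r' * t ^ r') := by gcongr
    _ = _ := by ring

/-- Every value of `x` is approximated by the values of `x` at nearby points of `S`. -/
def ApproxOn (S : Set E) (x : E → ℝ) : Prop :=
  ∀ U : E, ∀ ε > 0, ∃ u ∈ S, dist u U < ε ∧ |x u - x U| < ε

/-- Openness of `G` keeps the approximating pair from `S` inside it. -/
theorem ApproxOn.abs_sub_le {S : Set E} (hS : ApproxOn S x) {G : Set (E × E)} (hG : IsOpen G)
    {b : ℝ} (h : ∀ u ∈ S, ∀ v ∈ S, (u, v) ∈ G → |x u - x v| ≤ b) {U V : E} (hUV : (U, V) ∈ G) :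
    |x U - x V| ≤ b := by
  obtain ⟨ε, hε, hball⟩ := Metric.isOpen_iff.1 hG _ hUV
  refine le_of_forall_pos_le_add fun ε' hε' => ?_
  have hm : 0 < min ε (ε' / 2) := by positivity
  obtain ⟨u, hu, hu1, hu2⟩ := hS U _ hm
  obtain ⟨v, hv, hv1, hv2⟩ := hS V _ hm
  have h1 : (u, v) ∈ G := hball (by
    rw [Metric.mem_ball, Prod.dist_eq]
    exact max_lt (hu1.trans_le (min_le_left _ _)) (hv1.trans_le (min_le_left _ _)))
  have h2 := h u hu v hv h1
  have h3 := hu2.trans_le (min_le_right _ _)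
  have h4 := hv2.trans_le (min_le_right _ _)
  rw [abs_lt] at h3 h4
  rw [abs_le] at h2 ⊢
  constructor <;> linarith [h2.1, h2.2, h3.1, h3.2, h4.1, h4.2]

theorem exists_local_holder (hκ : IsScale κ) (hM : 0 ≤ M) (hg : ∀ n U, dist U (g n U) ≤ M * κ n)
    (hσ : ∀ U V, 0 ≤ σ U V) (hinc : IncrementsDominated κ g σ x) {S : Set E} (hS : ApproxOn S x)
    (hlim : ∀ U ∈ S, Tendsto (fun n => x (g n U)) atTop (𝓝 (x U)))
    {U₀ : E} {R C r r' : ℝ} (hR : 0 < R) (hC : 0 ≤ C) (hr' : 0 < r') (hr : r' < r)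
    (hbound : ∀ U ∈ Metric.ball U₀ R, ∀ V ∈ Metric.ball U₀ R, σ U V ≤ C * dist U V ^ r) :
    ∃ R' > 0, ∃ K, 0 ≤ K ∧ ∀ U ∈ Metric.ball U₀ R', ∀ V ∈ Metric.ball U₀ R',
      |x U - x V| ≤ K * dist U V ^ r' := by
  have hr0 : 0 < r := hr'.trans hr
  have hM2 : 0 ≤ 2 * M + 2 := by linarith
  -- This τ₀ ensures M τ < R / 2, so points within M τ of the half ball stay in the ball of radius
  -- R.
  obtain ⟨t₀, ht₀, K, hK, hchain⟩ := chain_bound (s := r) (r := r) (C₂ := C * (2 * M + 2) ^ r)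
    (τ₀ := R / (2 * (M + 1))) hκ hM hg hσ hinc hr0 hr' hr hC (by positivity) (by positivity)
  have hball : ∀ t, 0 < t → t < t₀ → ∀ U ∈ Metric.ball U₀ (R / 2), ∀ V ∈ Metric.ball U₀ (R / 2),
      dist U V < t → |x U - x V| ≤ K * t ^ r' := by
    intro t ht htt U hU V hV hUV
    have hGo : IsOpen ((Metric.ball U₀ (R / 2) ×ˢ Metric.ball U₀ (R / 2)) ∩
        {p : E × E | dist p.1 p.2 < t}) :=
      (Metric.isOpen_ball.prod Metric.isOpen_ball).inter
        (isOpen_lt (by fun_prop) continuous_const)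
    refine hS.abs_sub_le hGo (fun u hu v hv huv => ?_) (U := U) (V := V) ⟨⟨hU, hV⟩, hUV⟩
    obtain ⟨⟨hu1, hv1⟩, huv1⟩ := huv
    simp only [Metric.mem_ball, Set.mem_ofPred_eq] at hu1 hv1 huv1
    refine hchain t ht htt u v (hlim u hu) (hlim v hv) (by linarith) ?_
    intro τ hτ hτ₀ A B hA hB hAB
    have hτ0 : 0 < τ := ht.trans_le hτ
    have hMτ : M * τ < R / 2 := by
      rw [lt_div_iff₀ (by positivity)] at hτ₀
      nlinarith
    have hmem : ∀ W : E, (dist W u ≤ M * τ ∨ dist W v ≤ M * τ) → W ∈ Metric.ball U₀ R := by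
      rintro W (hW | hW)
      · exact Metric.mem_ball.2 (by linarith [dist_triangle W u U₀])
      · exact Metric.mem_ball.2 (by linarith [dist_triangle W v U₀])
    have h1 := hbound A (hmem A hA) B (hmem B hB)
    refine ⟨h1, h1.trans ?_⟩
    rw [mul_assoc, ← Real.mul_rpow hM2 hτ0.le]
    gcongr
  refine ⟨min (R / 2) (t₀ / 2), by positivity, K, hK, fun U hU V hV => ?_⟩
  have hU1 := Metric.ball_subset_ball (min_le_left _ _) hU
  have hV1 := Metric.ball_subset_ball (min_le_left _ _) hV
  have hU2 := Metric.mem_ball.1 (Metric.ball_subset_ball (min_le_right _ _) hU)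
  have hV2 := Metric.mem_ball.1 (Metric.ball_subset_ball (min_le_right _ _) hV)
  have hd : dist U V < t₀ := by linarith [dist_triangle_right U V U₀]
  -- Letting t decrease to the distance also covers distinct points at distance 0, where chaining
  -- needs t > 0.
  have hcont : Tendsto (fun t : ℝ => K * t ^ r') (𝓝[>] dist U V) (𝓝 (K * dist U V ^ r')) :=
    ((Real.continuousAt_rpow_const _ _ (Or.inr hr'.le)).const_mul K).mono_left
      nhdsWithin_le_nhds
  refine ge_of_tendsto hcont ?_
  filter_upwards [Ioo_mem_nhdsGT hd] with t ht
  exact hball t (dist_nonneg.trans_lt ht.1) ht.2 U hU1 V hV1 ht.1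

/-- The pointwise bound says nothing about close pairs away from U₀; a local bound with any `s` > 0
supplies the summability, without affecting the rate. -/
theorem exists_pointwise_holder (hκ : IsScale κ) (hM : 0 ≤ M)
    (hg : ∀ n U, dist U (g n U) ≤ M * κ n)
    (hσ : ∀ U V, 0 ≤ σ U V) (hinc : IncrementsDominated κ g σ x) {S : Set E} (hS : ApproxOn S x)
    (hlim : ∀ U ∈ S, Tendsto (fun n => x (g n U)) atTop (𝓝 (x U)))
    {U₀ : E} {R C s C₂ r r' : ℝ} (hR : 0 < R) (hC : 0 ≤ C) (hs : 0 < s) (hC₂ : 0 ≤ C₂)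
    (hr' : 0 < r') (hr : r' < r)
    (hbound : ∀ U ∈ Metric.ball U₀ R, ∀ V ∈ Metric.ball U₀ R, σ U V ≤ C * dist U V ^ s)
    (hbound₂ : ∀ ρ, 0 < ρ → ρ < R → ∀ U ∈ Metric.ball U₀ ρ, ∀ V ∈ Metric.ball U₀ ρ,
      σ U V ≤ C₂ * ρ ^ r) :
    ∃ R' > 0, ∃ K, 0 ≤ K ∧ ∀ ρ, 0 < ρ → ρ < R' → ∀ U ∈ Metric.ball U₀ ρ, ∀ V ∈ Metric.ball U₀ ρ,
      |x U - x V| ≤ K * ρ ^ r' := by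
  obtain ⟨t₀, ht₀, K, hK, hchain⟩ := chain_bound (s := s) (r := r) (C₂ := C₂ * (M + 1) ^ r)
    (τ₀ := R / (M + 1)) hκ hM hg hσ hinc hs hr' hr hC (by positivity) (by positivity)
  refine ⟨t₀, ht₀, K, hK, fun ρ hρ hρt U hU V hV => ?_⟩
  refine hS.abs_sub_le (Metric.isOpen_ball.prod Metric.isOpen_ball) (fun u hu v hv huv => ?_)
    (U := U) (V := V) ⟨hU, hV⟩
  obtain ⟨hu1, hv1⟩ := huv
  simp only [Metric.mem_ball] at hu1 hv1
  refine hchain ρ hρ hρt u v (hlim u hu) (hlim v hv)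
    (by linarith [dist_triangle_right u v U₀]) ?_
  intro τ hτ hτ₀ A B hA hB hAB
  have hτ0 : 0 < τ := hρ.trans_le hτ
  have hMτ : (M + 1) * τ < R := by
    rw [lt_div_iff₀ (by positivity)] at hτ₀
    linarith
  have hmem : ∀ W : E, (dist W u ≤ M * τ ∨ dist W v ≤ M * τ) →
      W ∈ Metric.ball U₀ ((M + 1) * τ) := by
    rintro W (hW | hW)
    · exact Metric.mem_ball.2 (by linarith [dist_triangle W u U₀])
    · exact Metric.mem_ball.2 (by linarith [dist_triangle W v U₀])
  have hsub := Metric.ball_subset_ball (x := U₀) hMτ.le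
  refine ⟨hbound A (hsub (hmem A hA)) B (hsub (hmem B hB)), ?_⟩
  rw [mul_assoc, ← Real.mul_rpow (by positivity) hτ0.le]
  exact hbound₂ _ (by positivity) hMτ A (hmem A hA) B (hmem B hB)

end Chaining

/-! ### Gaussian estimates and Borel–Cantelli -/

section Gaussian

open scoped NNReal

/-- Markov's inequality for the p-th moment of a standard normal, after scaling. The strict
inequality in the event makes v = 0 harmless. -/
theorem exists_gaussianReal_tail_le (p : ℕ) : ∃ c : ℝ, 0 ≤ c ∧ ∀ (v : ℝ≥0) (a : ℝ), 0 < a →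
    gaussianReal 0 v {y | a * √(v : ℝ) < |y|} ≤ ENNReal.ofReal (c * (a⁻¹) ^ p) := by
  have hint : Integrable (fun y : ℝ => |y| ^ p) (gaussianReal 0 1) := by
    rcases Nat.eq_zero_or_pos p with rfl | hp
    · simp
    · have := (memLp_id_gaussianReal (μ := 0) (v := 1) (p : ℝ≥0)).integrable_norm_pow (p := p)
        (by omega)
      simpa using this
  refine ⟨∫ y, |y| ^ p ∂gaussianReal 0 1, integral_nonneg fun y => by positivity, ?_⟩
  intro v a ha
  have hmap : gaussianReal 0 v = (gaussianReal 0 1).map (√(v : ℝ) * ·) := by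
    rw [gaussianReal_map_const_mul]
    congr 1
    · simp
    · ext; simp
  rw [hmap, Measure.map_apply (by fun_prop)
    (measurableSet_lt measurable_const (by fun_prop))]
  have hsub : (√(v : ℝ) * ·) ⁻¹' {y | a * √(v : ℝ) < |y|} ⊆ {y : ℝ | a ^ p ≤ |y| ^ p} := by
    intro y hy
    simp only [Set.mem_preimage, Set.mem_ofPred_eq, abs_mul, abs_of_nonneg (Real.sqrt_nonneg _)]
      at hy ⊢
    have : a < |y| := by
      rw [mul_comm] at hy
      exact lt_of_mul_lt_mul_left hy (Real.sqrt_nonneg _)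
    gcongr
  refine (measure_mono hsub).trans ?_
  have h1 := mul_meas_ge_le_integral_of_nonneg (Eventually.of_forall fun y => by positivity) hint
    (a ^ p)
  have h2 : (gaussianReal 0 1).real {y : ℝ | a ^ p ≤ |y| ^ p} ≤
      (∫ y, |y| ^ p ∂gaussianReal 0 1) * (a⁻¹) ^ p := by
    rw [inv_pow, ← div_eq_mul_inv, le_div_iff₀ (by positivity), mul_comm]
    exact h1
  rw [← ofReal_measureReal]
  exact ENNReal.ofReal_le_ofReal h2

/-- The density is at most 1/√v. The product form includes v = 0. -/
theorem sqrt_mul_gaussianReal_abs_le (v : ℝ≥0) (a : ℝ) :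
    ENNReal.ofReal √(v : ℝ) * gaussianReal 0 v {y | |y| ≤ a} ≤ ENNReal.ofReal (2 * a) := by
  rcases eq_or_ne v 0 with rfl | hv
  · simp
  have hv0 : (0 : ℝ) < v := by positivity
  have hs0 : 0 < √(v : ℝ) := Real.sqrt_pos.2 hv0
  have hset : {y : ℝ | |y| ≤ a} = Set.Icc (-a) a := by ext; simp [abs_le]
  have hpdf : ∀ y, gaussianPDF 0 v y ≤ ENNReal.ofReal (√(v : ℝ))⁻¹ := by
    intro y
    refine ENNReal.ofReal_le_ofReal ?_
    rw [gaussianPDFReal]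
    have h1 : Real.exp (-(y - 0) ^ 2 / (2 * v)) ≤ 1 := by
      rw [Real.exp_le_one_iff]
      have : 0 ≤ (y - 0) ^ 2 / (2 * v) := by positivity
      rw [neg_div]; linarith
    have h2 : (√(2 * Real.pi * v))⁻¹ ≤ (√(v : ℝ))⁻¹ := by
      gcongr
      nlinarith [Real.pi_gt_three]
    calc _ ≤ (√(v : ℝ))⁻¹ * 1 := by gcongr
      _ = _ := mul_one _
  rw [gaussianReal_apply 0 hv, hset]
  calc ENNReal.ofReal √(v : ℝ) * ∫⁻ y in Set.Icc (-a) a, gaussianPDF 0 v y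
      ≤ ENNReal.ofReal √(v : ℝ) *
        ∫⁻ y in Set.Icc (-a) a, ENNReal.ofReal (√(v : ℝ))⁻¹ := by gcongr; exact hpdf _
    _ = ENNReal.ofReal √(v : ℝ) * (ENNReal.ofReal (√(v : ℝ))⁻¹ * ENNReal.ofReal (2 * a)) := by
        rw [setLIntegral_const, Real.volume_Icc]; ring_nf
    _ = ENNReal.ofReal (2 * a) := by
        rw [← mul_assoc, ← ENNReal.ofReal_mul hs0.le, mul_inv_cancel₀ hs0.ne']; simp

variable {E Ω : Type*} [MeasurableSpace Ω] {P : Measure Ω} {X : E → Ω → ℝ}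

/-- Standard deviation of the increments of a process. -/
noncomputable def incStd (X : E → Ω → ℝ) (P : Measure Ω) (U V : E) : ℝ :=
  √(Var[X U - X V; P])

theorem incStd_nonneg (U V : E) : 0 ≤ incStd X P U V := Real.sqrt_nonneg _

theorem integral_increment (hX : IsGaussianProcess X P) (hX0 : ∀ U, ∫ ω, X U ω ∂P = 0)
    (U V : E) : ∫ ω, (X U - X V) ω ∂P = 0 := by
  simp only [Pi.sub_apply]
  rw [integral_sub (hX.hasGaussianLaw_eval U).integrable (hX.hasGaussianLaw_eval V).integrable,
    hX0, hX0, sub_zero]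

theorem lintegral_increment_sq (hX : IsGaussianProcess X P) (hX0 : ∀ U, ∫ ω, X U ω ∂P = 0)
    (U V : E) :
    ∫⁻ ω, ‖X U ω - X V ω‖ₑ ^ 2 ∂P = ENNReal.ofReal (incStd X P U V ^ 2) := by
  have := hX.isProbabilityMeasure
  rw [incStd, Real.sq_sqrt (variance_nonneg _ _),
    MemLp.ofReal_variance_eq hX.hasGaussianLaw_sub.memLp_two, evariance,
    integral_increment hX hX0]
  simp

theorem map_increment (hX : IsGaussianProcess X P) (hX0 : ∀ U, ∫ ω, X U ω ∂P = 0) (U V : E) :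
    P.map (X U - X V) = gaussianReal 0 (Var[X U - X V; P]).toNNReal := by
  rw [(hX.hasGaussianLaw_sub (s := U) (t := V)).map_eq_gaussianReal, integral_increment hX hX0]

theorem measure_increment_mem (hX : IsGaussianProcess X P) (hX0 : ∀ U, ∫ ω, X U ω ∂P = 0)
    (U V : E) {s : Set ℝ} (hs : MeasurableSet s) :
    P {ω | X U ω - X V ω ∈ s} = gaussianReal 0 (Var[X U - X V; P]).toNNReal s := by
  rw [← map_increment hX hX0, Measure.map_apply_of_aemeasurable
    hX.hasGaussianLaw_sub.aemeasurable hs]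
  rfl

theorem exists_increment_tail_le (hX : IsGaussianProcess X P) (hX0 : ∀ U, ∫ ω, X U ω ∂P = 0)
    (p : ℕ) : ∃ c : ℝ, 0 ≤ c ∧ ∀ (U V : E) (a : ℝ), 0 < a →
      P {ω | a * incStd X P U V < |X U ω - X V ω|} ≤ ENNReal.ofReal (c * (a⁻¹) ^ p) := by
  obtain ⟨c, hc, h⟩ := exists_gaussianReal_tail_le p
  refine ⟨c, hc, fun U V a ha => ?_⟩
  have h1 := h (Var[X U - X V; P]).toNNReal a ha
  rw [← measure_increment_mem hX hX0 U V (measurableSet_lt measurable_const (by fun_prop)),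
    Real.coe_toNNReal _ (variance_nonneg _ _)] at h1
  exact h1

theorem incStd_mul_measure_le (hX : IsGaussianProcess X P) (hX0 : ∀ U, ∫ ω, X U ω ∂P = 0)
    (U V : E) (a : ℝ) :
    ENNReal.ofReal (incStd X P U V) * P {ω | |X U ω - X V ω| ≤ a} ≤ ENNReal.ofReal (2 * a) := by
  have h1 := sqrt_mul_gaussianReal_abs_le (Var[X U - X V; P]).toNNReal a
  rw [← measure_increment_mem hX hX0 U V (measurableSet_le (by fun_prop) measurable_const),
    Real.coe_toNNReal _ (variance_nonneg _ _)] at h1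
  exact h1

/-- If the sample paths have a given modulus of continuity `w` on `B` with positive probability,
then so does the standard deviation of the increments, up to a constant. -/
theorem incStd_le_of_measure_ne_zero (hX : IsGaussianProcess X P)
    (hX0 : ∀ U, ∫ ω, X U ω ∂P = 0) {B : Set E} {w : E → E → ℝ} (hw : ∀ U V, 0 ≤ w U V)
    (h : P {ω | ∀ U ∈ B, ∀ V ∈ B, |X U ω - X V ω| ≤ w U V} ≠ 0) :
    ∃ C : ℝ, 0 ≤ C ∧ ∀ U ∈ B, ∀ V ∈ B, incStd X P U V ≤ C * w U V := by
  have := hX.isProbabilityMeasure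
  set p := P.real {ω | ∀ U ∈ B, ∀ V ∈ B, |X U ω - X V ω| ≤ w U V} with hp
  have hp0 : 0 < p := ENNReal.toReal_pos h (measure_ne_top _ _)
  refine ⟨2 / p, by positivity, fun U hU V hV => ?_⟩
  have h1 := incStd_mul_measure_le hX hX0 U V (w U V)
  have h2 : ENNReal.ofReal (incStd X P U V * p) ≤ ENNReal.ofReal (2 * w U V) := by
    rw [ENNReal.ofReal_mul (incStd_nonneg _ _), hp, ofReal_measureReal]
    refine le_trans ?_ h1
    gcongr
    intro hω
    exact hω U hU V hV
  rw [ENNReal.ofReal_le_ofReal_iff (by have := hw U V; positivity)] at h2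
  rw [div_mul_eq_mul_div, le_div_iff₀ hp0]
  exact h2

variable {κ : ℕ → ℝ} {g : ℕ → E → E}

theorem ae_incrementsDominated [PseudoMetricSpace E] (hX : IsGaussianProcess X P)
    (hX0 : ∀ U, ∫ ω, X U ω ∂P = 0) (hκ : IsScale κ) {D : ℕ → Finset E} (hD : Monotone D)
    (hgD : ∀ n U, g n U ∈ D n)
    (hcard : ∀ η : ℝ, 0 < η → ∃ p : ℕ, Summable fun n =>
      ((D n).card : ℝ) * ((D (n + 1)).card : ℝ) * (κ n ^ η) ^ p) :
    ∀ᵐ ω ∂P, IncrementsDominated κ g (incStd X P) fun U => X U ω := by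
  have hstep : ∀ η : ℝ, 0 < η → ∀ᵐ ω ∂P, ∀ᶠ n in atTop, ∀ U ∈ D n, ∀ V ∈ D (n + 1),
      |X U ω - X V ω| ≤ κ n ^ (-η) * incStd X P U V := by
    intro η hη
    obtain ⟨p, hp⟩ := hcard η hη
    obtain ⟨c, hc, htail⟩ := exists_increment_tail_le hX hX0 p
    have hmeas : ∀ n, P (⋃ U ∈ D n, ⋃ V ∈ D (n + 1),
        {ω | κ n ^ (-η) * incStd X P U V < |X U ω - X V ω|}) ≤
        ENNReal.ofReal (c * (((D n).card : ℝ) * ((D (n + 1)).card : ℝ) * (κ n ^ η) ^ p)) := by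
      intro n
      have hκn := hκ.pos n
      calc _ ≤ ∑ U ∈ D n, ∑ V ∈ D (n + 1), P {ω | κ n ^ (-η) * incStd X P U V < |X U ω - X V ω|} :=
            (measure_biUnion_finset_le _ _).trans
              (Finset.sum_le_sum fun U _ => measure_biUnion_finset_le _ _)
        _ ≤ ∑ U ∈ D n, ∑ V ∈ D (n + 1), ENNReal.ofReal (c * (κ n ^ η) ^ p) := by
            refine Finset.sum_le_sum fun U _ => Finset.sum_le_sum fun V _ => ?_
            have := htail U V (κ n ^ (-η)) (by positivity)
            rwa [Real.rpow_neg hκn.le, inv_inv, ← Real.rpow_neg hκn.le] at this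
        _ = _ := by
            simp only [Finset.sum_const, nsmul_eq_mul]
            rw [← ENNReal.ofReal_natCast, ← ENNReal.ofReal_natCast (D (n + 1)).card,
              ← ENNReal.ofReal_mul (by positivity), ← ENNReal.ofReal_mul (by positivity)]
            congr 1; ring
    have hsum : ∑' n, P (⋃ U ∈ D n, ⋃ V ∈ D (n + 1),
        {ω | κ n ^ (-η) * incStd X P U V < |X U ω - X V ω|}) ≠ ∞ :=
      ne_top_of_le_ne_top (hp.mul_left c).tsum_ofReal_ne_top (ENNReal.tsum_le_tsum hmeas)
    filter_upwards [ae_eventually_notMem hsum] with ω hω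
    filter_upwards [hω] with n hn U hU V hV
    simp only [Set.mem_iUnion, not_exists] at hn
    exact not_lt.1 (hn U hU V hV)
  -- Countably many η suffice, because `κ n` ≤ 1 makes the bound monotone in η.
  have hall : ∀ᵐ ω ∂P, ∀ j : ℕ, ∀ᶠ n in atTop, ∀ U ∈ D n, ∀ V ∈ D (n + 1),
      |X U ω - X V ω| ≤ κ n ^ (-(1 / ((j : ℝ) + 1))) * incStd X P U V :=
    ae_all_iff.2 fun j => hstep _ (by positivity)
  filter_upwards [hall] with ω hω η hη
  obtain ⟨j, hj⟩ := exists_nat_one_div_lt hη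
  filter_upwards [hω j] with n hn U V
  have hmono : κ n ^ (-(1 / ((j : ℝ) + 1))) ≤ κ n ^ (-η) :=
    Real.rpow_le_rpow_of_exponent_ge (hκ.pos n) (hκ.le_one n) (by linarith)
  refine ⟨(hn _ (hgD n U) _ (hD n.le_succ (hgD n V))).trans ?_,
    (hn _ (hgD n U) _ (hgD (n + 1) V)).trans ?_⟩
  all_goals exact mul_le_mul_of_nonneg_right hmono (incStd_nonneg _ _)

/-- The exceptional set depends on `U`, so this serves only for countably many points. One increment
per level makes the first moment enough. -/
theorem ae_tendsto_approx [PseudoMetricSpace E] (hX : IsGaussianProcess X P)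
    (hX0 : ∀ U, ∫ ω, X U ω ∂P = 0) (hκ : IsScale κ) {M : ℝ} (hM : 0 ≤ M)
    (hg : ∀ n U, dist U (g n U) ≤ M * κ n) {U : E} {R C s : ℝ} (hR : 0 < R) (hC : 0 ≤ C)
    (hs : 0 < s) (hbound : ∀ V ∈ Metric.ball U R, incStd X P U V ≤ C * dist U V ^ s) :
    ∀ᵐ ω ∂P, Tendsto (fun n => X (g n U) ω) atTop (𝓝 (X U ω)) := by
  obtain ⟨c, hc, htail⟩ := exists_increment_tail_le hX hX0 1
  have hsum : ∑' n,
      P {ω | κ n ^ (-(s / 2)) * incStd X P U (g n U) < |X U ω - X (g n U) ω|} ≠ ∞ := by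
    refine ne_top_of_le_ne_top ((hκ.summable (s / 2) (by positivity)).mul_left c).tsum_ofReal_ne_top
      (ENNReal.tsum_le_tsum fun n => ?_)
    have hκn := hκ.pos n
    have := htail U (g n U) (κ n ^ (-(s / 2))) (by positivity)
    rwa [pow_one, Real.rpow_neg hκn.le, inv_inv, ← Real.rpow_neg hκn.le] at this
  filter_upwards [ae_eventually_notMem hsum] with ω hω
  rw [tendsto_iff_dist_tendsto_zero]
  have hlim : Tendsto (fun n => C * M ^ s * κ n ^ (s / 2)) atTop (𝓝 0) := by
    simpa using (hκ.summable (s / 2) (by positivity)).tendsto_atTop_zero.const_mul (C * M ^ s)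
  have hsmall : ∀ᶠ n in atTop, M * κ n < R := by
    have := hκ.tendsto.const_mul M
    rw [mul_zero] at this
    exact this.eventually_lt_const hR
  refine squeeze_zero' (Eventually.of_forall fun _ => dist_nonneg) ?_ hlim
  filter_upwards [hω, hsmall] with n hn hnR
  have hκn := hκ.pos n
  rw [dist_comm, Real.dist_eq]
  refine (not_lt.1 hn).trans ?_
  have h1 := hbound (g n U) (by rw [Metric.mem_ball, dist_comm]; exact (hg n U).trans_lt hnR)
  have h2 : incStd X P U (g n U) ≤ C * (M * κ n) ^ s := h1.trans (by gcongr; exact hg n U)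
  calc κ n ^ (-(s / 2)) * incStd X P U (g n U)
      ≤ κ n ^ (-(s / 2)) * (C * (M * κ n) ^ s) := by gcongr
    _ = C * M ^ s * (κ n ^ (-(s / 2)) * κ n ^ s) := by rw [Real.mul_rpow hM hκn.le]; ring
    _ = _ := by rw [← Real.rpow_add hκn]; congr 2; ring

theorem IsSeparableProcess.exists_approxOn [PseudoMetricSpace E] (h : IsSeparableProcess X P) :
    ∃ S : Set E, S.Countable ∧ ∀ᵐ ω ∂P, ApproxOn S fun U => X U ω := by
  obtain ⟨S, hS, Λ, hΛ, h⟩ := h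
  refine ⟨S, hS, ?_⟩
  have hΛ' : ∀ᵐ ω ∂P, ω ∉ Λ := measure_eq_zero_iff_ae_notMem.1 hΛ
  filter_upwards [hΛ'] with ω hω U ε hε
  -- The closed set tested depends on ω; this is allowed because `Λ` does not depend on the closed
  -- set.
  have hmem : X U ω ∈ closure ((fun V => X V ω) '' (Metric.ball U ε ∩ S)) := by
    by_contra hcon
    refine hω (h (closure ((fun V => X V ω) '' (Metric.ball U ε ∩ S))) isClosed_closure
      (Metric.ball U ε) Metric.isOpen_ball
      ⟨fun V hV => subset_closure ⟨V, hV, rfl⟩, fun hall => hcon (hall U ?_)⟩)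
    exact Metric.mem_ball_self hε
  obtain ⟨_, ⟨u, ⟨hu, huS⟩, rfl⟩, hd⟩ := Metric.mem_closure_iff.1 hmem ε hε
  refine ⟨u, huS, hu, ?_⟩
  rwa [dist_comm, Real.dist_eq] at hd

end Gaussian

/-! ### Exponents and explicit power bounds -/

section ExponentBounds

variable {E : Type*} [PseudoMetricSpace E]

theorem limsup_ball_lt_top_iff (Q : ℝ → E → E → ℝ≥0∞) (x₀ : E) :
    limsup (fun ρ : ℝ => ⨆ U ∈ Metric.ball x₀ ρ, ⨆ V ∈ Metric.ball x₀ ρ, Q ρ U V) (𝓝[>] 0) < ∞ ↔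
      ∃ R > 0, ∃ K : ℝ, 0 ≤ K ∧ ∀ ρ, 0 < ρ → ρ < R → ∀ U ∈ Metric.ball x₀ ρ,
        ∀ V ∈ Metric.ball x₀ ρ, Q ρ U V ≤ ENNReal.ofReal K := by
  constructor
  · intro h
    obtain ⟨K, hK, hKtop⟩ := exists_between h
    obtain ⟨R, hR, hRK⟩ := mem_nhdsGT_iff_exists_Ioo_subset.1 (eventually_lt_of_limsup_lt hK)
    refine ⟨R, hR, K.toReal, ENNReal.toReal_nonneg, fun ρ hρ hρR U hU V hV => ?_⟩
    rw [ENNReal.ofReal_toReal hKtop.ne]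
    have h1 : (⨆ U ∈ Metric.ball x₀ ρ, ⨆ V ∈ Metric.ball x₀ ρ, Q ρ U V) < K := hRK ⟨hρ, hρR⟩
    refine le_trans ?_ h1.le
    exact (le_iSup₂ (f := fun V (_ : V ∈ Metric.ball x₀ ρ) => Q ρ U V) V hV).trans
      (le_iSup₂ (f := fun U (_ : U ∈ Metric.ball x₀ ρ) => ⨆ V ∈ Metric.ball x₀ ρ, Q ρ U V) U hU)
  · rintro ⟨R, hR, K, -, h⟩
    refine lt_of_le_of_lt (limsup_le_of_le (a := ENNReal.ofReal K) (by isBoundedDefault) ?_)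
      ENNReal.ofReal_lt_top
    filter_upwards [Ioo_mem_nhdsGT hR] with ρ hρ
    exact iSup₂_le fun U hU => iSup₂_le fun V hV => h ρ hρ.1 hρ.2 U hU V hV

theorem ofReal_div_rpow_le_iff {a b K α : ℝ} (hb : 0 ≤ b) (hK : 0 ≤ K) (hα : 0 ≤ α) :
    ENNReal.ofReal a / ENNReal.ofReal b ^ α ≤ ENNReal.ofReal K ↔ a ≤ K * b ^ α := by
  rw [ENNReal.ofReal_rpow_of_nonneg hb hα,
    ENNReal.div_le_iff_le_mul (Or.inr ENNReal.ofReal_ne_top) (Or.inl ENNReal.ofReal_ne_top),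
    ← ENNReal.ofReal_mul hK, ENNReal.ofReal_le_ofReal_iff (by positivity)]

variable {F : E → E → ℝ} {x₀ : E} {c r : ℝ}

/-- The factor `c` is 1 for sample paths and 2 for variances of increments. -/
theorem exists_le_dist_rpow_of_lt (hc : 0 < c) (hr : 0 < r)
    (h : (r : EReal) < ⨆ α ∈ {α : ℝ | limsup (fun ρ : ℝ => ⨆ U ∈ Metric.ball x₀ ρ,
      ⨆ V ∈ Metric.ball x₀ ρ, ENNReal.ofReal (F U V) / edist U V ^ (c * α)) (𝓝[>] 0) < ∞},
        (α : EReal)) :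
    ∃ R > 0, ∃ K, 0 ≤ K ∧ ∀ U ∈ Metric.ball x₀ R, ∀ V ∈ Metric.ball x₀ R,
      F U V ≤ K * dist U V ^ (c * r) := by
  simp only [lt_iSup_iff] at h
  obtain ⟨α, hα, hrα⟩ := h
  rw [EReal.coe_lt_coe_iff] at hrα
  have hα0 := hr.trans hrα
  obtain ⟨R, hR, K, hK, hQ⟩ := (limsup_ball_lt_top_iff _ _).1 hα
  -- R / 2 leaves a radius strictly below R; 1 / 2 makes distances at most 1, so that lowering the
  -- exponent weakens the bound.
  refine ⟨min (R / 2) (1 / 2), by positivity, K, hK, fun U hU V hV => ?_⟩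
  have h1 := hQ _ (by positivity) ((min_le_left _ _).trans_lt (half_lt_self hR)) U hU V hV
  rw [edist_dist, ofReal_div_rpow_le_iff dist_nonneg hK (by positivity)] at h1
  have hd : dist U V ≤ 1 := by
    have hU2 := Metric.mem_ball.1 (Metric.ball_subset_ball (min_le_right _ _) hU)
    have hV2 := Metric.mem_ball.1 (Metric.ball_subset_ball (min_le_right _ _) hV)
    linarith [dist_triangle_right U V x₀]
  refine h1.trans (mul_le_mul_of_nonneg_left ?_ hK)
  exact Real.rpow_le_rpow_of_exponent_ge_of_imp dist_nonneg hd (by gcongr)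
    (fun _ h0 => absurd h0 (by positivity))

theorem exists_le_radius_rpow_of_lt (hc : 0 < c) (hr : 0 < r)
    (h : (r : EReal) < ⨆ α ∈ {α : ℝ | limsup (fun ρ : ℝ => ⨆ U ∈ Metric.ball x₀ ρ,
      ⨆ V ∈ Metric.ball x₀ ρ, ENNReal.ofReal (F U V) / ENNReal.ofReal ρ ^ (c * α)) (𝓝[>] 0) < ∞},
        (α : EReal)) :
    ∃ R > 0, ∃ K, 0 ≤ K ∧ ∀ ρ, 0 < ρ → ρ < R → ∀ U ∈ Metric.ball x₀ ρ, ∀ V ∈ Metric.ball x₀ ρ,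
      F U V ≤ K * ρ ^ (c * r) := by
  simp only [lt_iSup_iff] at h
  obtain ⟨α, hα, hrα⟩ := h
  rw [EReal.coe_lt_coe_iff] at hrα
  have hα0 := hr.trans hrα
  obtain ⟨R, hR, K, hK, hQ⟩ := (limsup_ball_lt_top_iff _ _).1 hα
  refine ⟨min R 1, by positivity, K, hK, fun ρ hρ hρR U hU V hV => ?_⟩
  have h1 := hQ ρ hρ (hρR.trans_le (min_le_left _ _)) U hU V hV
  rw [ofReal_div_rpow_le_iff hρ.le hK (by positivity)] at h1
  refine h1.trans (mul_le_mul_of_nonneg_left ?_ hK)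
  exact Real.rpow_le_rpow_of_exponent_ge hρ (hρR.le.trans (min_le_right _ _)) (by gcongr)

theorem le_iSup_of_le_dist_rpow (hc : 0 < c) (hr : 0 < r) {R K : ℝ} (hR : 0 < R) (hK : 0 ≤ K)
    (h : ∀ U ∈ Metric.ball x₀ R, ∀ V ∈ Metric.ball x₀ R, F U V ≤ K * dist U V ^ (c * r)) :
    (r : EReal) ≤ ⨆ α ∈ {α : ℝ | limsup (fun ρ : ℝ => ⨆ U ∈ Metric.ball x₀ ρ,
      ⨆ V ∈ Metric.ball x₀ ρ, ENNReal.ofReal (F U V) / edist U V ^ (c * α)) (𝓝[>] 0) < ∞},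
        (α : EReal) := by
  refine le_iSup₂ (f := fun (α : ℝ) _ => (α : EReal)) r ?_
  refine (limsup_ball_lt_top_iff _ _).2 ⟨R, hR, K, hK, fun ρ _ hρR U hU V hV => ?_⟩
  rw [edist_dist, ofReal_div_rpow_le_iff dist_nonneg hK (by positivity)]
  exact h U (Metric.ball_subset_ball hρR.le hU) V (Metric.ball_subset_ball hρR.le hV)

theorem le_iSup_of_le_radius_rpow (hc : 0 < c) (hr : 0 < r) {R K : ℝ} (hR : 0 < R) (hK : 0 ≤ K)
    (h : ∀ ρ, 0 < ρ → ρ < R → ∀ U ∈ Metric.ball x₀ ρ, ∀ V ∈ Metric.ball x₀ ρ,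
      F U V ≤ K * ρ ^ (c * r)) :
    (r : EReal) ≤ ⨆ α ∈ {α : ℝ | limsup (fun ρ : ℝ => ⨆ U ∈ Metric.ball x₀ ρ,
      ⨆ V ∈ Metric.ball x₀ ρ, ENNReal.ofReal (F U V) / ENNReal.ofReal ρ ^ (c * α)) (𝓝[>] 0) < ∞},
        (α : EReal) := by
  refine le_iSup₂ (f := fun (α : ℝ) _ => (α : EReal)) r ?_
  refine (limsup_ball_lt_top_iff _ _).2 ⟨R, hR, K, hK, fun ρ hρ hρR U hU V hV => ?_⟩
  rw [ofReal_div_rpow_le_iff hρ.le hK (by positivity)]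
  exact h ρ hρ hρR U hU V hV

theorem exists_abs_sub_le_of_lt_localExponent {f : E → ℝ} (hr : 0 < r)
    (h : (r : EReal) < localExponent f x₀) :
    ∃ R > 0, ∃ K, 0 ≤ K ∧ ∀ U ∈ Metric.ball x₀ R, ∀ V ∈ Metric.ball x₀ R,
      |f U - f V| ≤ K * dist U V ^ r := by
  have := exists_le_dist_rpow_of_lt (F := fun U V => |f U - f V|) (x₀ := x₀) one_pos hr
  simp only [one_mul, ← Real.enorm_eq_ofReal_abs] at this
  exact this h

theorem le_localExponent {f : E → ℝ} (hr : 0 < r) {R K : ℝ} (hR : 0 < R) (hK : 0 ≤ K)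
    (h : ∀ U ∈ Metric.ball x₀ R, ∀ V ∈ Metric.ball x₀ R, |f U - f V| ≤ K * dist U V ^ r) :
    (r : EReal) ≤ localExponent f x₀ := by
  have := le_iSup_of_le_dist_rpow (F := fun U V => |f U - f V|) (x₀ := x₀) one_pos hr hR hK
  simp only [one_mul, ← Real.enorm_eq_ofReal_abs] at this
  exact this h

theorem le_pointwiseExponent {f : E → ℝ} (hr : 0 < r) {R K : ℝ} (hR : 0 < R) (hK : 0 ≤ K)
    (h : ∀ ρ, 0 < ρ → ρ < R → ∀ U ∈ Metric.ball x₀ ρ, ∀ V ∈ Metric.ball x₀ ρ,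
      |f U - f V| ≤ K * ρ ^ r) :
    (r : EReal) ≤ pointwiseExponent f x₀ := by
  have := le_iSup_of_le_radius_rpow (F := fun U V => |f U - f V|) (x₀ := x₀) one_pos hr hR hK
  simp only [one_mul, ← Real.enorm_eq_ofReal_abs] at this
  exact this h

variable {Ω : Type*} [MeasurableSpace Ω] {P : Measure Ω} {X : E → Ω → ℝ}

theorem le_sqrt_mul_rpow {a b K : ℝ} (hb : 0 ≤ b) (hK : 0 ≤ K) (h : a ^ 2 ≤ K * b ^ (2 * r)) :
    a ≤ √K * b ^ r := by
  refine le_of_pow_le_pow_left₀ two_ne_zero (by positivity) ?_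
  rw [mul_pow, Real.sq_sqrt hK, ← Real.rpow_mul_natCast hb, Nat.cast_ofNat, mul_comm r]
  exact h

theorem exists_incStd_le_of_lt_detLocalExponent (hX : IsGaussianProcess X P)
    (hX0 : ∀ U, ∫ ω, X U ω ∂P = 0) (hr : 0 < r) (h : (r : EReal) < detLocalExponent X P x₀) :
    ∃ R > 0, ∃ K, 0 ≤ K ∧ ∀ U ∈ Metric.ball x₀ R, ∀ V ∈ Metric.ball x₀ R,
      incStd X P U V ≤ K * dist U V ^ r := by
  have := exists_le_dist_rpow_of_lt (F := fun U V => incStd X P U V ^ 2) (x₀ := x₀) two_pos hr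
  simp only [← lintegral_increment_sq hX hX0] at this
  obtain ⟨R, hR, K, hK, hb⟩ := this h
  exact ⟨R, hR, √K, Real.sqrt_nonneg _, fun U hU V hV =>
    le_sqrt_mul_rpow dist_nonneg hK (hb U hU V hV)⟩

theorem exists_incStd_le_of_lt_detPointwiseExponent (hX : IsGaussianProcess X P)
    (hX0 : ∀ U, ∫ ω, X U ω ∂P = 0) (hr : 0 < r) (h : (r : EReal) < detPointwiseExponent X P x₀) :
    ∃ R > 0, ∃ K, 0 ≤ K ∧ ∀ ρ, 0 < ρ → ρ < R → ∀ U ∈ Metric.ball x₀ ρ, ∀ V ∈ Metric.ball x₀ ρ,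
      incStd X P U V ≤ K * ρ ^ r := by
  have := exists_le_radius_rpow_of_lt (F := fun U V => incStd X P U V ^ 2) (x₀ := x₀) two_pos hr
  simp only [← lintegral_increment_sq hX hX0] at this
  obtain ⟨R, hR, K, hK, hb⟩ := this h
  exact ⟨R, hR, √K, Real.sqrt_nonneg _, fun ρ hρ hρR U hU V hV =>
    le_sqrt_mul_rpow hρ.le hK (hb ρ hρ hρR U hU V hV)⟩

theorem le_detLocalExponent (hX : IsGaussianProcess X P)
    (hX0 : ∀ U, ∫ ω, X U ω ∂P = 0) (hr : 0 < r) {R K : ℝ} (hR : 0 < R)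
    (h : ∀ U ∈ Metric.ball x₀ R, ∀ V ∈ Metric.ball x₀ R, incStd X P U V ≤ K * dist U V ^ r) :
    (r : EReal) ≤ detLocalExponent X P x₀ := by
  have := le_iSup_of_le_dist_rpow (F := fun U V => incStd X P U V ^ 2) (x₀ := x₀) (K := K ^ 2)
    two_pos hr hR (by positivity)
  simp only [← lintegral_increment_sq hX hX0] at this
  refine this fun U hU V hV => ?_
  rw [mul_comm 2 r, ← Nat.cast_ofNat (R := ℝ) (n := 2), Real.rpow_mul_natCast dist_nonneg,
    ← mul_pow]
  exact pow_le_pow_left₀ (incStd_nonneg _ _) (h U hU V hV) 2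

end ExponentBounds

/-! ### Almost sure comparison of the exponents -/

section SamplePaths

variable {E : Type*} [PseudoMetricSpace E] {Ω : Type*} [MeasurableSpace Ω] {P : Measure Ω}
  {X : E → Ω → ℝ} {κ : ℕ → ℝ} {g : ℕ → E → E} {M : ℝ}

theorem liminf_nhds_le (φ : E → EReal) (U : E) : liminf φ (𝓝 U) ≤ φ U :=
  liminf_le_of_frequently_le' fun h => h.self_of_nhds le_rfl

theorem ae_exponents_ge (hX : IsGaussianProcess X P) (hX0 : ∀ U, ∫ ω, X U ω ∂P = 0)
    (hXsep : IsSeparableProcess X P) (hκ : IsScale κ) (hM : 0 ≤ M)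
    (hg : ∀ n U, dist U (g n U) ≤ M * κ n) {D : ℕ → Finset E} (hD : Monotone D)
    (hgD : ∀ n U, g n U ∈ D n)
    (hcard : ∀ η : ℝ, 0 < η → ∃ p : ℕ, Summable fun n =>
      ((D n).card : ℝ) * ((D (n + 1)).card : ℝ) * (κ n ^ η) ^ p)
    (hloc : ∀ U, 0 < detLocalExponent X P U) (hpt : ∀ U, 0 < detPointwiseExponent X P U) :
    ∀ᵐ ω ∂P, ∀ U, detLocalExponent X P U ≤ localExponent (fun V => X V ω) U ∧
      detPointwiseExponent X P U ≤ pointwiseExponent (fun V => X V ω) U := by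
  obtain ⟨S, hSc, hS⟩ := hXsep.exists_approxOn
  have hreg : ∀ U, ∃ s : ℝ, 0 < s ∧ ∃ R > 0, ∃ C, 0 ≤ C ∧ ∀ V ∈ Metric.ball U R,
      ∀ W ∈ Metric.ball U R, incStd X P V W ≤ C * dist V W ^ s := by
    intro U
    obtain ⟨s, hs, hsU⟩ := EReal.lt_iff_exists_real_btwn.1 (hloc U)
    have hs0 : 0 < s := EReal.coe_pos.1 hs
    exact ⟨s, hs0, exists_incStd_le_of_lt_detLocalExponent hX hX0 hs0 hsU⟩
  have hlim : ∀ᵐ ω ∂P, ∀ U ∈ S, Tendsto (fun n => X (g n U) ω) atTop (𝓝 (X U ω)) := by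
    refine (ae_ball_iff hSc).2 fun U _ => ?_
    obtain ⟨s, hs, R, hR, C, hC, hb⟩ := hreg U
    exact ae_tendsto_approx hX hX0 hκ hM hg hR hC hs (hb U (Metric.mem_ball_self hR))
  -- Positivity of b confines the comparison to positive exponents; the gap between r' and r pays
  -- for the loss in chaining.
  have hbtwn : ∀ {a b : EReal}, 0 < b → (∀ r' r : ℝ, 0 < r' → r' < r → (r : EReal) < b →
      (r' : EReal) ≤ a) → b ≤ a := by
    intro a b hb h
    by_contra! hlt
    obtain ⟨r', h1, h2⟩ := EReal.lt_iff_exists_real_btwn.1 (max_lt hb hlt)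
    obtain ⟨r, h3, h4⟩ := EReal.lt_iff_exists_real_btwn.1 h2
    exact absurd (h r' r (EReal.coe_pos.1 ((le_max_left _ _).trans_lt h1))
      (EReal.coe_lt_coe_iff.1 h3) h4) (not_le.2 ((le_max_right _ _).trans_lt h1))
  filter_upwards [hS, hlim, ae_incrementsDominated hX hX0 hκ hD hgD hcard] with ω hω hωlim hωinc U₀
  constructor
  · refine hbtwn (hloc U₀) fun r' r hr' hr hrb => ?_
    obtain ⟨R, hR, C, hC, hb⟩ := exists_incStd_le_of_lt_detLocalExponent hX hX0 (hr'.trans hr) hrb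
    obtain ⟨R', hR', K, hK, hx⟩ := exists_local_holder hκ hM hg incStd_nonneg hωinc hω hωlim
      hR hC hr' hr hb
    exact le_localExponent hr' hR' hK hx
  · refine hbtwn (hpt U₀) fun r' r hr' hr hrb => ?_
    obtain ⟨R₂, hR₂, C₂, hC₂, hb₂⟩ :=
      exists_incStd_le_of_lt_detPointwiseExponent hX hX0 (hr'.trans hr) hrb
    obtain ⟨s, hs, R, hR, C, hC, hb⟩ := hreg U₀
    have hsub : Metric.ball U₀ (min R R₂) ⊆ Metric.ball U₀ R :=
      Metric.ball_subset_ball (min_le_left _ _)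
    obtain ⟨R', hR', K, hK, hx⟩ := exists_pointwise_holder (R := min R R₂) hκ hM hg incStd_nonneg
      hωinc hω hωlim (lt_min hR hR₂) hC hs hC₂ hr' hr
      (fun U hU V hV => hb U (hsub hU) V (hsub hV))
      (fun ρ hρ hρR => hb₂ ρ hρ (hρR.trans_le (min_le_right _ _)))
    exact le_pointwiseExponent hr' hR' hK hx

theorem ae_localExponent_le (hX : IsGaussianProcess X P) (hX0 : ∀ U, ∫ ω, X U ω ∂P = 0)
    (hg : ∀ U, Tendsto (fun n => g n U) atTop (𝓝 U)) {D : ℕ → Finset E}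
    (hgD : ∀ n U, g n U ∈ D n) (hloc : ∀ U, 0 < detLocalExponent X P U) :
    ∀ᵐ ω ∂P, ∀ U, localExponent (fun V => X V ω) U ≤ limsup (detLocalExponent X P) (𝓝 U) := by
  have hmain : ∀ᵐ ω ∂P, ∀ n, ∀ c ∈ D n, ∀ (j : ℕ) (r : ℚ) (K : ℕ),
      (∀ U ∈ Metric.ball c (1 / ((j : ℝ) + 1)), ∀ V ∈ Metric.ball c (1 / ((j : ℝ) + 1)),
        |X U ω - X V ω| ≤ K * dist U V ^ (r : ℝ)) →
      ∃ C : ℝ, 0 ≤ C ∧ ∀ U ∈ Metric.ball c (1 / ((j : ℝ) + 1)),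
        ∀ V ∈ Metric.ball c (1 / ((j : ℝ) + 1)), incStd X P U V ≤ C * dist U V ^ (r : ℝ) := by
    refine ae_all_iff.2 fun n => (ae_ball_iff (D n).countable_toSet).2 fun c _ =>
      ae_all_iff.2 fun j => ae_all_iff.2 fun r => ae_all_iff.2 fun K => ?_
    -- Either the path bound fails almost surely, or its positive probability forces a deterministic
    -- bound valid for every ω.
    by_cases h : P {ω | ∀ U ∈ Metric.ball c (1 / ((j : ℝ) + 1)),
        ∀ V ∈ Metric.ball c (1 / ((j : ℝ) + 1)), |X U ω - X V ω| ≤ K * dist U V ^ (r : ℝ)} = 0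
    · filter_upwards [measure_eq_zero_iff_ae_notMem.1 h] with ω hω hω'
      exact absurd hω' hω
    · obtain ⟨C, hC, hb⟩ := incStd_le_of_measure_ne_zero hX hX0 (fun U V => by positivity) h
      refine Eventually.of_forall fun ω _ => ⟨C * K, by positivity, fun U hU V hV => ?_⟩
      rw [mul_assoc]
      exact hb U hU V hV
  filter_upwards [hmain] with ω hω U₀
  by_contra! hlt
  obtain ⟨r, hr1, hr2⟩ := EReal.lt_iff_exists_rat_btwn.1 hlt
  have hev := eventually_lt_of_limsup_lt hr1
  have hr0 : (0 : ℝ) < (r : ℝ) := EReal.coe_pos.1 ((hloc U₀).trans hev.self_of_nhds)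
  obtain ⟨R₁, hR₁, h1⟩ := Metric.eventually_nhds_iff_ball.1 hev
  obtain ⟨R₂, hR₂, K, hK, h2⟩ := exists_abs_sub_le_of_lt_localExponent hr0 hr2
  -- The half lets a ball centered at a nearby `g n U₀` fit in the ball around U₀. The contradiction
  -- arises at that center, hence the limsup over neighbors.
  obtain ⟨j, hj⟩ := exists_nat_one_div_lt (half_pos (lt_min hR₁ hR₂))
  have hj0 : 0 < 1 / ((j : ℝ) + 1) := by positivity
  obtain ⟨n, hn⟩ := ((hg U₀).eventually (Metric.ball_mem_nhds U₀ hj0)).exists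
  have hsub : Metric.ball (g n U₀) (1 / ((j : ℝ) + 1)) ⊆ Metric.ball U₀ (min R₁ R₂) := by
    intro W hW
    have hW1 := Metric.mem_ball.1 hW
    have hn1 := Metric.mem_ball.1 hn
    exact Metric.mem_ball.2 (by linarith [dist_triangle W (g n U₀) U₀])
  obtain ⟨K', hK'⟩ := exists_nat_ge K
  obtain ⟨C, -, hb⟩ := hω n (g n U₀) (hgD n U₀) j r K' (fun U hU V hV =>
    (h2 U (Metric.ball_subset_ball (min_le_right _ _) (hsub hU)) V
      (Metric.ball_subset_ball (min_le_right _ _) (hsub hV))).trans (by gcongr))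
  have h3 := le_detLocalExponent hX hX0 hr0 hj0 hb
  exact absurd (h1 _ (Metric.ball_subset_ball (min_le_left _ _)
    (hsub (Metric.mem_ball_self hj0)))) (not_lt.2 h3)

end SamplePaths

/-! ### Scales from admissible cardinals -/

section Scale

/-- Admissible growth of the cardinals makes their negative powers a sequence of scales. -/
theorem isScale_of_admissible {k : ℕ → ℝ} (hk1 : ∀ n, 1 ≤ k n) (hk : Monotone k)
    (hadm : ∀ δ : ℝ, 0 < δ → Summable fun n => k (n + 1) / k n ^ (1 + δ)) {q : ℝ} (hq : 0 < q) :
    IsScale fun n => k n ^ (-1 / q) := by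
  have hk0 : ∀ n, 0 < k n := fun n => one_pos.trans_le (hk1 n)
  have hneg : -1 / q ≤ 0 := div_nonpos_of_nonpos_of_nonneg (by norm_num) hq.le
  refine ⟨fun n => Real.rpow_pos_of_pos (hk0 n) _,
    fun n => Real.rpow_le_one_of_one_le_of_nonpos (hk1 n) hneg,
    fun m n hmn => Real.rpow_le_rpow_of_nonpos (hk0 m) (hk hmn) hneg, fun η hη => ?_,
    fun δ hδ => ?_⟩
  -- By monotonicity, k_n ^ (-η/q) ≤ k_{n+1} / k_n ^ (1 + η/q).
  · refine Summable.of_nonneg_of_le (fun n => by have := hk0 n; positivity) (fun n => ?_)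
      (hadm (η / q) (by positivity))
    have hkn := hk0 n
    rw [← Real.rpow_mul hkn.le, le_div_iff₀ (by positivity), ← Real.rpow_add hkn]
    have : -1 / q * η + (1 + η / q) = 1 := by ring
    rw [this, Real.rpow_one]
    exact hk n.le_succ
  · have hs := hadm δ hδ
    have hnn : ∀ n, 0 ≤ k (n + 1) / k n ^ (1 + δ) := fun n => by
      have := hk0 n; have := hk0 (n + 1); positivity
    set A := (∑' n, k (n + 1) / k n ^ (1 + δ)) + 1 with hA
    have hA0 : 0 < A := add_pos_of_nonneg_of_pos (tsum_nonneg hnn) one_pos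
    refine ⟨A ^ (1 / q), by positivity, fun n => ?_⟩
    have hkn := hk0 n
    have hkn1 := hk0 (n + 1)
    -- Each term of the convergent series is at most its sum; the negative power -1/q then reverses
    -- the inequality.
    have h1 : k (n + 1) ≤ A * k n ^ (1 + δ) := by
      rw [← div_le_iff₀ (by positivity)]
      exact (hs.le_tsum n fun m _ => hnn m).trans (by linarith)
    have h2 := Real.rpow_le_rpow_of_nonpos hkn1 h1 hneg
    rw [Real.mul_rpow hA0.le (by positivity), ← Real.rpow_mul hkn.le] at h2
    calc (k n ^ (-1 / q)) ^ (1 + δ)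
        = A ^ (1 / q) * (A ^ (-1 / q) * k n ^ ((1 + δ) * (-1 / q))) := by
          rw [← mul_assoc, ← Real.rpow_add hA0, ← Real.rpow_mul hkn.le]
          have : 1 / q + -1 / q = 0 := by ring
          rw [this, Real.rpow_zero, one_mul, mul_comm (1 + δ)]
      _ ≤ A ^ (1 / q) * k (n + 1) ^ (-1 / q) := by gcongr

theorem exists_summable_card_of_admissible {k : ℕ → ℝ} (hk1 : ∀ n, 1 ≤ k n)
    (hadm : ∀ δ : ℝ, 0 < δ → Summable fun n => k (n + 1) / k n ^ (1 + δ)) {q : ℝ} (hq : 0 < q)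
    {η : ℝ} (hη : 0 < η) :
    ∃ p : ℕ, Summable fun n => k n * k (n + 1) * ((k n ^ (-1 / q)) ^ η) ^ p := by
  have hk0 : ∀ n, 0 < k n := fun n => one_pos.trans_le (hk1 n)
  -- Then pη/q ≥ 3, and the terms are at most k_{n+1} / k_n ^ 2: admissibility with δ = 1.
  obtain ⟨p, hp⟩ := exists_nat_ge (3 * q / η)
  refine ⟨p, Summable.of_nonneg_of_le (fun n => ?_) (fun n => ?_) (hadm 1 one_pos)⟩
  · have := hk0 n; have := hk0 (n + 1); positivity
  have hkn := hk0 n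
  have hkn1 := hk0 (n + 1)
  rw [← Real.rpow_mul hkn.le, ← Real.rpow_mul_natCast hkn.le]
  have h1 : k n ^ (-1 / q * η * p) ≤ k n ^ (-3 : ℝ) := by
    refine Real.rpow_le_rpow_of_exponent_le (hk1 n) ?_
    rw [div_le_iff₀ hη] at hp
    have : -1 / q * η * p = -((p * η) / q) := by ring
    rw [this, neg_le_neg_iff, le_div_iff₀ hq]
    exact hp
  calc k n * k (n + 1) * k n ^ (-1 / q * η * p) ≤ k n * k (n + 1) * k n ^ (-3 : ℝ) := by gcongr
    _ = k (n + 1) * (k n ^ (1 : ℝ) * k n ^ (-3 : ℝ)) := by rw [Real.rpow_one]; ring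
    _ = k (n + 1) / k n ^ ((1 : ℝ) + 1) := by
      rw [← Real.rpow_add hkn, div_eq_mul_inv, ← Real.rpow_neg hkn.le]; norm_num

end Scale

end SetIndexed

theorem mainTheorem3 {T : Type*} [MetricSpace T] [CompleteSpace T] [LocallyCompactSpace T]
    [TopologicalSpace.SeparableSpace T]
    (𝓐 : Set (Set T)) (h𝓐 : SetIndexed.IsIndexingCollection 𝓐)
    (𝓐seq : ℕ → Set (Set T)) (hsep : SetIndexed.SeparatesFromAbove 𝓐 𝓐seq)
    (hadm : SetIndexed.Admissible 𝓐seq)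
    [PseudoMetricSpace 𝓐] (hdisc : SetIndexed.DiscretizationAssumption hsep)
    {Ω : Type*} [MeasurableSpace Ω] (P : Measure Ω) [IsProbabilityMeasure P]
    (X : 𝓐 → Ω → ℝ) (hgauss : IsGaussianProcess X P) (hcent : ∀ U, ∫ ω, X U ω ∂P = 0)
    (hXsep : SetIndexed.IsSeparableProcess X P)
    (hloc : ∀ U₀ : 𝓐, 0 < liminf (SetIndexed.detLocalExponent X P) (𝓝 U₀))
    (hpt : ∀ U₀ : 𝓐, 0 < liminf (SetIndexed.detPointwiseExponent X P) (𝓝 U₀)) :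
    (∀ᵐ ω ∂P, ∀ U₀ : 𝓐,
      liminf (SetIndexed.detLocalExponent X P) (𝓝 U₀)
          ≤ SetIndexed.localExponent (fun U => X U ω) U₀ ∧
        SetIndexed.localExponent (fun U => X U ω) U₀
          ≤ limsup (SetIndexed.detLocalExponent X P) (𝓝 U₀)) ∧
    (∀ᵐ ω ∂P, ∀ U₀ : 𝓐,
      liminf (SetIndexed.detPointwiseExponent X P) (𝓝 U₀)
        ≤ SetIndexed.pointwiseExponent (fun U => X U ω) U₀) := by
  obtain ⟨q, hq, M, hM, hd⟩ := hdisc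
  have hk1 : ∀ n, (1 : ℝ) ≤ ((𝓐seq n).ncard : ℝ) := fun n => by
    exact_mod_cast (Set.ncard_pos (hsep.finite n)).2 ⟨∅, hsep.empty_mem n⟩
  have hk : Monotone fun n => ((𝓐seq n).ncard : ℝ) := fun m n hmn =>
    Nat.cast_le.2 (Set.ncard_le_ncard (hsep.mono hmn) (hsep.finite n))
  have hκ := SetIndexed.isScale_of_admissible hk1 hk hadm hq
  have hfin : ∀ n, {U : 𝓐 | (U : Set T) ∈ 𝓐seq n}.Finite := fun n =>
    (hsep.finite n).preimage Subtype.val_injective.injOn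
  have hcard : ∀ n, ((hfin n).toFinset.card : ℝ) = ((𝓐seq n).ncard : ℝ) := fun n => by
    rw [← Set.ncard_eq_toFinset_card _ (hfin n),
      ← Set.ncard_image_of_injective _ Subtype.val_injective]
    congr 2
    exact Subtype.image_preimage_val 𝓐 (𝓐seq n) |>.trans
      (Set.inter_eq_right.2 (hsep.subset n))
  have hD : Monotone fun n => (hfin n).toFinset := fun m n hmn =>
    Set.Finite.toFinset_subset_toFinset.2 fun U hU => hsep.mono hmn hU
  have hgD : ∀ n U, hsep.g n U ∈ (hfin n).toFinset := fun n U =>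
    (hfin n).mem_toFinset.2 (hsep.approx_mem n U U.2)
  have hloc' : ∀ U, 0 < SetIndexed.detLocalExponent X P U := fun U =>
    (hloc U).trans_le (SetIndexed.liminf_nhds_le _ U)
  have hpt' : ∀ U, 0 < SetIndexed.detPointwiseExponent X P U := fun U =>
    (hpt U).trans_le (SetIndexed.liminf_nhds_le _ U)
  have hglim : ∀ U, Tendsto (fun n => hsep.g n U) atTop (𝓝 U) := fun U => by
    rw [tendsto_iff_dist_tendsto_zero]
    refine squeeze_zero (fun _ => dist_nonneg) (fun n => ?_)
      (by simpa using hκ.tendsto.const_mul M)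
    rw [dist_comm]
    exact hd n U
  have hge := SetIndexed.ae_exponents_ge hgauss hcent hXsep hκ hM.le hd hD hgD
    (fun η hη => by
      simpa only [hcard] using SetIndexed.exists_summable_card_of_admissible hk1 hadm hq hη)
    hloc' hpt'
  have hle := SetIndexed.ae_localExponent_le hgauss hcent hglim hgD hloc'
  constructor
  · filter_upwards [hge, hle] with ω h1 h2 U
    exact ⟨(SetIndexed.liminf_nhds_le _ U).trans (h1 U).1, h2 U⟩
  · filter_upwards [hge] with ω h1 U
    exact (SetIndexed.liminf_nhds_le _ U).trans (h1 U).2
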